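/- Let $\mathfrak H_1,\mathfrak H_2$ be complex Hilbert spaces and $\mathfrak H=\mathfrak H_1\oplus\mathfrak H_2$. Let linear operators $T_{11}^\circ\colon\operatorname{dom}T_{11}^\circ\to\mathfrak H_1$, $T_{12}^\circ\colon\operatorname{dom}T_{22}^\circ\to\mathfrak H_1$, $T_{21}^\circ\colon\operatorname{dom}T_{11}^\circ\to\mathfrak H_2$, $T_{22}^\circ\colon\operatorname{dom}T_{22}^\circ\to\mathfrak H_2$ (with $\operatorname{dom}T_{ii}^\circ\subseteq\mathfrak H_i$) be such that the operator matrix $$T^\circ=\begin{pmatrix}T_{11}^\circ&T_{12}^\circ\\T_{21}^\circ&T_{22}^\circ\end{pmatrix},\qquad \operatorname{dom}T^\circ=\operatorname{dom}T_{11}^\circ\oplus\operatorname{dom}T_{22}^\circ,$$ is a (densely defined) symmetric operator in $\mathfrak H$. Suppose that $T_{11}^\circ$ is bounded below and $T_{22}^\circ$ is bounded above, and fix any $\varkappa,\tau\in\mathbb R$ with $$\langle(T_{11}^\circ-\varkappa)y,y\rangle\ge\|y\|^2\ \ (y\in\operatorname{dom}T_{11}^\circ),\qquad \langle(\tau-T_{22}^\circ)y,y\rangle\ge\|y\|^2\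 \ (y\in\operatorname{dom}T_{22}^\circ).$$ For a Hilbert space $\mathfrak D$ with an injective bounded embedding $I\colon\mathfrak D\to\mathfrak H$ with dense image, let $\mathfrak D^*$ be the space of continuous conjugate-linear functionals on $\mathfrak D$ and $I^*\colon\mathfrak H\to\mathfrak D^*$, $(I^*h)(z)=\langle h,Iz\rangle$. For a bounded $T\colon\mathfrak D\to\mathfrak D^*$ let $T^\bullet=(I^*)^{-1}TI^{-1}$ be the operator in $\mathfrak H$ with graph $\{(Iy,h): y\in\mathfrak D,\ h\in\mathfrak H,\ Ty=I^*h\}$ (and similarly for $\mathfrak H_2$ in place of $\mathfrak H$). Let $\mathfrak D_2$ be the completion of $\operatorname{dom}T_{22}^\circ$ in the norm $\|y\|_{\mathfrak D_2}=\langle(\tau-T_{22}^\circ)y,y\rangle^{1/2}$, let $I_2\colon\mathfrak D_2\to\mathfrak H_2$ be the corresponding embedding, and let $T_{22}^\bullet=(I_2^*)^{-1}T_{22}I_2^{-1}$ be the Friedrichs extension of $T_{22}^\circ$, where $T_{22}\colon\mathfrak D_2\to\mathfrak D_2^*$ is the bounded extension of $I_2^*T_{22}^\circ I_2$. Let $\mathfrak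 D_1$ be the completion of $\operatorname{dom}T_{11}^\circ$ in the norm $$\|y\|_{\mathfrak D_1}=\left[\langle(T_{11}^\circ-\varkappa)y,y\rangle+\langle(\tau-T_{22}^\bullet)^{-1}T_{21}^\circ y,T_{21}^\circ y\rangle\right]^{1/2},$$ with the corresponding embedding $I_1\colon\mathfrak D_1\to\mathfrak H_1$. Put $\mathfrak D=\mathfrak D_1\oplus\mathfrak D_2$, $I=I_1\oplus I_2$, let $T\colon\mathfrak D\to\mathfrak D^*$ be the bounded operator that is the closure of $I^*T^\circ I$, and call $T^\bullet=(I^*)^{-1}TI^{-1}$ the angular extension of $T^\circ$. Then the angular extension $T^\bullet$ is a self-adjoint operator in $\mathfrak H$. -/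

import Mathlib

open scoped ComplexConjugate

noncomputable section

set_option linter.unusedSectionVars false

/-! ### Rigged Hilbert spaces `D → H → D^*` -/

namespace Rigging

variable {H D V : Type*} [NormedAddCommGroup H] [InnerProductSpace ℂ H]
  [NormedAddCommGroup D] [InnerProductSpace ℂ D] [AddCommGroup V] [Module ℂ V]

/-- The conjugate space `D^*`: continuous conjugate-linear functionals on `D`. -/
abbrev AntiDual (D : Type*) [NormedAddCommGroup D] [InnerProductSpace ℂ D] : Type _ :=
  D →L⋆[ℂ] ℂ

/-- For an embedding `I : D → H`, the map `I^* : H → D^*`, `(I^* h) z = ⟨h, I z⟩`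
(in Mathlib's convention `⟨h, I z⟩` is `inner ℂ (I z) h`). -/
def dualMap (I : D →L[ℂ] H) : H →ₗ[ℂ] AntiDual D where
  toFun h := (innerSLFlip ℂ h).comp I
  map_add' x y := by ext z; simp
  map_smul' c x := by ext z; simp

@[simp] lemma dualMap_apply (I : D →L[ℂ] H) (h : H) (z : D) :
    dualMap I h z = inner ℂ (I z) h := by
  simp [dualMap]

/-- Given an operator `A` on a dense linear set `V` of `D` (embedded by `j : V → D`) with values
in `H`, the continuous extension `D → D^*` of the operator `j v ↦ I^* (A v)`. -/
def extension (I : D →L[ℂ] H) (j : V →ₗ[ℂ] D) (A : V →ₗ[ℂ] H) : D →L[ℂ] AntiDual D :=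
  (dualMap I ∘ₗ A).extendOfNorm j

lemma extension_apply (I : D →L[ℂ] H) (j : V →ₗ[ℂ] D) (A : V →ₗ[ℂ] H) (hj : DenseRange j)
    (C : ℝ) (hC : 0 ≤ C)
    (hb : ∀ x z : V, ‖(inner ℂ (I (j z)) (A x) : ℂ)‖ ≤ C * ‖j x‖ * ‖j z‖) (x : V) :
    extension I j A (j x) = dualMap I (A x) := by
  unfold extension
  rw [LinearMap.extendOfNorm_eq hj ⟨C, fun x => ?_⟩]
  · rfl
  · refine ContinuousLinearMap.opNorm_le_bound _ (by positivity) fun z => ?_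
    refine hj.induction_on (p := fun z => ‖(dualMap I ∘ₗ A) x z‖ ≤ C * ‖j x‖ * ‖z‖) z
      (isClosed_le (by fun_prop) (by fun_prop)) fun z => ?_
    simpa using hb x z

/-- The graph `{(I y, h) : T y = I^* h}` of `T^• = (I^*)⁻¹ T I⁻¹`. -/
def bulletGraph (I : D →L[ℂ] H) (T : D →L[ℂ] AntiDual D) : Submodule ℂ (H × H) where
  carrier := {p | ∃ y : D, I y = p.1 ∧ T y = dualMap I p.2}
  add_mem' := by
    rintro p q ⟨y, hy, hy'⟩ ⟨z, hz, hz'⟩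
    exact ⟨y + z, by simp [hy, hz], by simp [hy', hz']⟩
  zero_mem' := ⟨0, by simp, by simp⟩
  smul_mem' := by
    rintro c p ⟨y, hy, hy'⟩
    exact ⟨c • y, by simp [hy], by simp [hy']⟩

/-- The operator `T^• = (I^*)⁻¹ T I⁻¹` in `H`. -/
def bullet (I : D →L[ℂ] H) (T : D →L[ℂ] AntiDual D) : H →ₗ.[ℂ] H :=
  (bulletGraph I T).toLinearPMap

lemma dualMap_injective (I : D →L[ℂ] H) (hI : DenseRange I) :
    Function.Injective (dualMap I) := by
  rw [injective_iff_map_eq_zero]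
  intro h hh
  refine hI.eq_zero_of_inner_right ℂ fun y => ?_
  simpa using DFunLike.congr_fun hh y

lemma mem_graph_bullet (I : D →L[ℂ] H) (T : D →L[ℂ] AntiDual D) (hI : Function.Injective I)
    (hd : DenseRange I) (x h : H) :
    (x, h) ∈ (bullet I T).graph ↔ ∃ y : D, I y = x ∧ T y = dualMap I h := by
  unfold bullet
  rw [Submodule.toLinearPMap_graph_eq]
  · rfl
  · rintro ⟨x, h⟩ ⟨y, hy, hy'⟩ (rfl : x = 0)
    have : y = 0 := hI (by simpa using hy)
    subst this
    exact dualMap_injective I hd (by simpa using hy'.symm)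

end Rigging

/-! ### Energy spaces -/

/-- A Hermitian form on a linear set of `H` which majorizes the square of the norm of `H`. -/
structure EnergyForm (H : Type*) [NormedAddCommGroup H] [InnerProductSpace ℂ H] where
  dom : Submodule ℂ H
  form : dom → dom → ℂ
  conj_symm : ∀ x y : dom, conj (form y x) = form x y
  add_left : ∀ x y z : dom, form (x + y) z = form x z + form y z
  smul_left : ∀ (x y : dom) (c : ℂ), form (c • x) y = conj c * form x y
  coercive : ∀ x : dom, ‖(x : H)‖ ^ 2 ≤ (form x x).re

namespace EnergyForm

variable {H : Type*} [NormedAddCommGroup H] [InnerProductSpace ℂ H] (E : EnergyForm H)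

/-- The linear set `E.dom` regarded as a pre-Hilbert space with the scalar product `E.form`. -/
def Pre : Type _ := E.dom

instance : AddCommGroup E.Pre := inferInstanceAs (AddCommGroup E.dom)
instance : Module ℂ E.Pre := inferInstanceAs (Module ℂ E.dom)

@[reducible] def core : InnerProductSpace.Core ℂ E.Pre where
  inner x y := E.form x y
  conj_inner_symm x y := E.conj_symm x y
  re_inner_nonneg x := (sq_nonneg _).trans (E.coercive x)
  add_left x y z := E.add_left x y z
  smul_left x y c := E.smul_left x y c
  definite x hx := by
    have h := E.coercive x
    have hx' : E.form x x = 0 := hx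
    rw [hx'] at h
    have h0 : ‖(Subtype.val (p := fun y => y ∈ E.dom) x : H)‖ = 0 := by
      have := norm_nonneg (Subtype.val (p := fun y => y ∈ E.dom) x : H)
      simp only [Complex.zero_re] at h
      nlinarith
    exact Subtype.ext (norm_eq_zero.mp h0)

instance : NormedAddCommGroup E.Pre := E.core.toNormedAddCommGroup
instance : InnerProductSpace ℂ E.Pre := InnerProductSpace.ofCore E.core.toCore

/-- The completion of `E.dom` with respect to the norm `E.form y y ^ (1/2)`. -/
abbrev Space : Type _ := UniformSpace.Completion E.Pre

/-- The canonical map of `E.dom` into its completion. -/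
def embed : E.dom →ₗ[ℂ] E.Space :=
  (UniformSpace.Completion.toComplL (𝕜 := ℂ) (E := E.Pre)).toLinearMap

lemma inner_embed (x y : E.dom) :
    (inner ℂ (E.embed x) (E.embed y) : ℂ) = E.form x y :=
  UniformSpace.Completion.inner_coe (𝕜 := ℂ) (E := E.Pre) x y

lemma norm_embed_sq (x : E.dom) : ‖E.embed x‖ ^ 2 = (E.form x x).re := by
  rw [← E.inner_embed, ← inner_self_eq_norm_sq (𝕜 := ℂ)]
  rfl

lemma denseRange_embed : DenseRange E.embed :=
  UniformSpace.Completion.denseRange_coe (α := E.Pre)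

lemma norm_le (x : E.dom) : ‖(x : H)‖ ≤ ‖E.embed x‖ := by
  refine le_of_sq_le_sq ?_ (norm_nonneg _)
  rw [E.norm_embed_sq]
  exact E.coercive x

variable [CompleteSpace H]

/-- The embedding operator of the completion into `H`: the continuous extension of the
inclusion `E.dom → H`. -/
def incl : E.Space →L[ℂ] H := E.dom.subtype.extendOfNorm E.embed

@[simp] lemma incl_embed (x : E.dom) : E.incl (E.embed x) = x :=
  LinearMap.extendOfNorm_eq E.denseRange_embed
    ⟨1, fun x => by simpa using E.norm_le x⟩ x

lemma denseRange_incl (hd : Dense (E.dom : Set H)) : DenseRange E.incl := by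
  refine hd.mono ?_
  intro x hx
  exact ⟨E.embed ⟨x, hx⟩, E.incl_embed _⟩

/-- A criterion for `E.incl` to be injective. -/
lemma incl_injective
    (h : ∀ y : E.Space, E.incl y = 0 → ∀ z : E.dom, (inner ℂ y (E.embed z) : ℂ) = 0) :
    Function.Injective E.incl := by
  rw [injective_iff_map_eq_zero]
  intro y hy
  refine E.denseRange_embed.eq_zero_of_inner_left ℂ fun z => ?_
  exact h y hy z

end EnergyForm

/-! ### Symmetric operator matrices -/

/-- The entries of an operator matrix in `H₁ ⊕ H₂`. -/
structure OperatorMatrix (H₁ H₂ : Type*) [NormedAddCommGroup H₁] [InnerProductSpace ℂ H₁]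
    [NormedAddCommGroup H₂] [InnerProductSpace ℂ H₂] where
  T₁₁ : H₁ →ₗ.[ℂ] H₁
  T₂₂ : H₂ →ₗ.[ℂ] H₂
  T₁₂ : T₂₂.domain →ₗ[ℂ] H₁
  T₂₁ : T₁₁.domain →ₗ[ℂ] H₂

namespace OperatorMatrix

variable {H₁ H₂ : Type*} [NormedAddCommGroup H₁] [InnerProductSpace ℂ H₁]
  [NormedAddCommGroup H₂] [InnerProductSpace ℂ H₂]

/-- The operator in `H₁ ⊕ H₂` with domain `dom T₁₁ ⊕ dom T₂₂` given by an operator matrix. -/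
def toOperator (T : OperatorMatrix H₁ H₂) :
    WithLp 2 (H₁ × H₂) →ₗ.[ℂ] WithLp 2 (H₁ × H₂) where
  domain := (T.T₁₁.domain.prod T.T₂₂.domain).comap
    (WithLp.linearEquiv 2 ℂ (H₁ × H₂)).toLinearMap
  toFun :=
    { toFun := fun p => WithLp.toLp 2
        (T.T₁₁ ⟨p.1.fst, p.2.1⟩ + T.T₁₂ ⟨p.1.snd, p.2.2⟩,
          T.T₂₁ ⟨p.1.fst, p.2.1⟩ + T.T₂₂ ⟨p.1.snd, p.2.2⟩)
      map_add' := fun p q => by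
        rw [← WithLp.toLp_add, Prod.mk_add_mk]
        congr 2
        · rw [add_add_add_comm, ← map_add, ← T.T₁₁.map_add]; rfl
        · rw [add_add_add_comm, ← map_add, ← T.T₂₂.map_add]; rfl
      map_smul' := fun c p => by
        rw [RingHom.id_apply, ← WithLp.toLp_smul, Prod.smul_mk, smul_add, smul_add]
        simp only [← map_smul, ← LinearPMap.map_smul]
        rfl }

/-- The operator matrix is symmetric: its operator is densely defined and symmetric. -/
def IsSymmetric (T : OperatorMatrix H₁ H₂) : Prop :=
  Dense (T.toOperator.domain : Set (WithLp 2 (H₁ × H₂))) ∧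
    T.toOperator.IsFormalAdjoint T.toOperator

end OperatorMatrix

/-- A symmetric operator matrix with `⟨(T₁₁ - ϰ) y, y⟩ ≥ ‖y‖²` and `⟨(τ - T₂₂) y, y⟩ ≥ ‖y‖²`. -/
structure AngularData (H₁ H₂ : Type*) [NormedAddCommGroup H₁] [InnerProductSpace ℂ H₁]
    [NormedAddCommGroup H₂] [InnerProductSpace ℂ H₂] extends OperatorMatrix H₁ H₂ where
  ϰ : ℝ
  τ : ℝ
  symm : toOperatorMatrix.IsSymmetric
  lower : ∀ y : T₁₁.domain, ‖(y : H₁)‖ ^ 2 ≤ (inner ℂ (y : H₁) (T₁₁ y - (ϰ : ℂ) • (y : H₁))).re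
  upper : ∀ y : T₂₂.domain, ‖(y : H₂)‖ ^ 2 ≤ (inner ℂ (y : H₂) ((τ : ℂ) • (y : H₂) - T₂₂ y)).re

namespace AngularData

variable {H₁ H₂ : Type*} [NormedAddCommGroup H₁] [InnerProductSpace ℂ H₁]
  [NormedAddCommGroup H₂] [InnerProductSpace ℂ H₂] (S : AngularData H₁ H₂)

lemma symm_aux (x y : S.T₁₁.domain) (u v : S.T₂₂.domain) :
    (inner ℂ (S.T₁₁ x + S.T₁₂ u) (y : H₁) + inner ℂ (S.T₂₁ x + S.T₂₂ u) (v : H₂) : ℂ) =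
      inner ℂ (x : H₁) (S.T₁₁ y + S.T₁₂ v) + inner ℂ (u : H₂) (S.T₂₁ y + S.T₂₂ v) := by
  have h := S.symm.2 ⟨WithLp.toLp 2 ((x : H₁), (u : H₂)), x.2, u.2⟩
    ⟨WithLp.toLp 2 ((y : H₁), (v : H₂)), y.2, v.2⟩
  exact h

lemma symm₁₁ (x y : S.T₁₁.domain) :
    (inner ℂ (S.T₁₁ x) (y : H₁) : ℂ) = inner ℂ (x : H₁) (S.T₁₁ y) := by
  simpa using S.symm_aux x y 0 0

lemma symm₂₂ (x y : S.T₂₂.domain) :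
    (inner ℂ (S.T₂₂ x) (y : H₂) : ℂ) = inner ℂ (x : H₂) (S.T₂₂ y) := by
  simpa using S.symm_aux 0 0 x y

lemma symm₂₁ (x : S.T₁₁.domain) (v : S.T₂₂.domain) :
    (inner ℂ (S.T₂₁ x) (v : H₂) : ℂ) = inner ℂ (x : H₁) (S.T₁₂ v) := by
  simpa using S.symm_aux x 0 0 v

lemma dense₁ : Dense (S.T₁₁.domain : Set H₁) := by
  have h := S.symm.1.denseRange_val
  have h1 : DenseRange fun p : WithLp 2 (H₁ × H₂) => p.fst :=
    Function.Surjective.denseRange fun x => ⟨WithLp.toLp 2 (x, 0), rfl⟩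
  refine (h1.comp h (by fun_prop)).mono ?_
  rintro _ ⟨p, rfl⟩
  exact p.2.1

lemma dense₂ : Dense (S.T₂₂.domain : Set H₂) := by
  have h := S.symm.1.denseRange_val
  have h1 : DenseRange fun p : WithLp 2 (H₁ × H₂) => p.snd :=
    Function.Surjective.denseRange fun x => ⟨WithLp.toLp 2 (0, x), rfl⟩
  refine (h1.comp h (by fun_prop)).mono ?_
  rintro _ ⟨p, rfl⟩
  exact p.2.2

/-- The form `⟨(τ - T₂₂) x, y⟩` on `dom T₂₂`. -/
def energy₂ : EnergyForm H₂ where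
  dom := S.T₂₂.domain
  form x y := inner ℂ (x : H₂) ((S.τ : ℂ) • (y : H₂) - S.T₂₂ y)
  conj_symm x y := by
    rw [inner_conj_symm, inner_sub_left, inner_sub_right, S.symm₂₂ x y, inner_smul_left,
      inner_smul_right, Complex.conj_ofReal]
  add_left x y z := by simp only [Submodule.coe_add, inner_add_left]
  smul_left x y c := by simp only [Submodule.coe_smul, inner_smul_left]
  coercive x := S.upper x

variable [CompleteSpace H₂]

/-- The space `D₂`. -/
abbrev D₂ : Type _ := S.energy₂.Space

/-- The embedding operator `I₂ : D₂ → H₂`. -/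
def I₂ : S.D₂ →L[ℂ] H₂ := S.energy₂.incl

/-- The embedding of `dom T₂₂` into `D₂`. -/
def j₂ : S.T₂₂.domain →ₗ[ℂ] S.D₂ := S.energy₂.embed

@[simp] lemma I₂_j₂ (x : S.T₂₂.domain) : S.I₂ (S.j₂ x) = x := S.energy₂.incl_embed x

lemma dense_j₂ : DenseRange S.j₂ := S.energy₂.denseRange_embed

lemma dense_I₂ : DenseRange S.I₂ := S.energy₂.denseRange_incl S.dense₂

lemma inner_j₂ (x y : S.T₂₂.domain) :
    (inner ℂ (S.j₂ x) (S.j₂ y) : ℂ) = inner ℂ (x : H₂) ((S.τ : ℂ) • (y : H₂) - S.T₂₂ y) :=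
  S.energy₂.inner_embed x y

lemma inner_j₂' (y : S.D₂) (z : S.T₂₂.domain) :
    (inner ℂ y (S.j₂ z) : ℂ) = inner ℂ (S.I₂ y) ((S.τ : ℂ) • (z : H₂) - S.T₂₂ z) := by
  refine S.dense_j₂.induction_on (p := fun y => (inner ℂ y (S.j₂ z) : ℂ) =
    inner ℂ (S.I₂ y) ((S.τ : ℂ) • (z : H₂) - S.T₂₂ z)) y
    (isClosed_eq (by fun_prop) (by fun_prop)) fun y => ?_
  rw [S.inner_j₂, S.I₂_j₂]

lemma I₂_injective : Function.Injective S.I₂ :=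
  S.energy₂.incl_injective fun y hy z => by
    refine (S.inner_j₂' y z).trans ?_
    rw [show S.I₂ y = 0 from hy, inner_zero_left]

/-- The bounded operator `D₂ → D₂^*` extending `I₂^* T₂₂ I₂`. -/
def T₂₂Ext : S.D₂ →L[ℂ] Rigging.AntiDual S.D₂ :=
  Rigging.extension S.I₂ S.j₂ S.T₂₂.toFun

/-- The Friedrichs extension `T₂₂^•` of `T₂₂`. -/
def friedrichs₂₂ : H₂ →ₗ.[ℂ] H₂ := Rigging.bullet S.I₂ S.T₂₂Ext

lemma norm_I₂_le (y : S.D₂) : ‖S.I₂ y‖ ≤ ‖y‖ := by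
  refine S.dense_j₂.induction_on (p := fun y => ‖S.I₂ y‖ ≤ ‖y‖) y
    (isClosed_le (by fun_prop) (by fun_prop)) fun y => ?_
  rw [S.I₂_j₂]
  exact S.energy₂.norm_le y

lemma bound₂₂ (x z : S.T₂₂.domain) :
    ‖(inner ℂ (S.I₂ (S.j₂ z)) (S.T₂₂ x) : ℂ)‖ ≤ (|S.τ| + 1) * ‖S.j₂ x‖ * ‖S.j₂ z‖ := by
  have h : (inner ℂ (S.I₂ (S.j₂ z)) (S.T₂₂ x) : ℂ) =
      S.τ * inner ℂ (S.I₂ (S.j₂ z)) (S.I₂ (S.j₂ x)) - inner ℂ (S.j₂ z) (S.j₂ x) := by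
    rw [S.inner_j₂, S.I₂_j₂, S.I₂_j₂, inner_sub_right, inner_smul_right]; ring
  rw [h]
  refine (norm_sub_le _ _).trans ?_
  rw [norm_mul, Complex.norm_real, Real.norm_eq_abs]
  have h1 : ‖(inner ℂ (S.I₂ (S.j₂ z)) (S.I₂ (S.j₂ x)) : ℂ)‖ ≤ ‖S.j₂ z‖ * ‖S.j₂ x‖ :=
    (norm_inner_le_norm _ _).trans
      (mul_le_mul (S.norm_I₂_le _) (S.norm_I₂_le _) (norm_nonneg _) (norm_nonneg _))
  have h2 := norm_inner_le_norm (𝕜 := ℂ) (S.j₂ z) (S.j₂ x)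
  nlinarith [mul_le_mul_of_nonneg_left h1 (abs_nonneg S.τ)]

lemma T₂₂Ext_j₂ (x : S.T₂₂.domain) :
    S.T₂₂Ext (S.j₂ x) = Rigging.dualMap S.I₂ (S.T₂₂ x) :=
  Rigging.extension_apply S.I₂ S.j₂ S.T₂₂.toFun S.dense_j₂ (|S.τ| + 1) (by positivity)
    S.bound₂₂ x

lemma T₂₂Ext_apply (y z : S.D₂) :
    S.T₂₂Ext y z = S.τ * inner ℂ (S.I₂ z) (S.I₂ y) - inner ℂ z y := by
  refine S.dense_j₂.induction_on (p := fun z => S.T₂₂Ext y z =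
    S.τ * inner ℂ (S.I₂ z) (S.I₂ y) - inner ℂ z y) z
    (isClosed_eq (by fun_prop) (by fun_prop)) fun z => ?_
  refine S.dense_j₂.induction_on (p := fun y => S.T₂₂Ext y (S.j₂ z) =
    S.τ * inner ℂ (S.I₂ (S.j₂ z)) (S.I₂ y) - inner ℂ (S.j₂ z) y) y
    (isClosed_eq (by fun_prop) (by fun_prop)) fun y => ?_
  rw [S.T₂₂Ext_j₂, Rigging.dualMap_apply, S.inner_j₂]
  simp only [I₂_j₂, inner_sub_right, inner_smul_right]
  ring

lemma mem_graph_friedrichs₂₂ (x h : H₂) : (x, h) ∈ S.friedrichs₂₂.graph ↔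
    S.I₂ (S.I₂.adjoint ((S.τ : ℂ) • x - h)) = x := by
  have key : ∀ y : S.D₂, S.T₂₂Ext y = Rigging.dualMap S.I₂ h ↔
      y = S.I₂.adjoint ((S.τ : ℂ) • S.I₂ y - h) := by
    intro y
    constructor
    · intro hy
      refine ext_inner_left ℂ fun z => ?_
      have := DFunLike.congr_fun hy z
      rw [S.T₂₂Ext_apply, Rigging.dualMap_apply] at this
      rw [ContinuousLinearMap.adjoint_inner_right, inner_sub_right, inner_smul_right, ← this]
      ring
    · intro hy
      ext z
      have := congrArg (fun w => (inner ℂ z w : ℂ)) hy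
      simp only [ContinuousLinearMap.adjoint_inner_right, inner_sub_right,
        inner_smul_right] at this
      rw [S.T₂₂Ext_apply, Rigging.dualMap_apply, this]
      ring
  rw [friedrichs₂₂, Rigging.mem_graph_bullet _ _ S.I₂_injective S.dense_I₂]
  constructor
  · rintro ⟨y, rfl, hy⟩
    rw [← (key y).1 hy]
  · intro hx
    exact ⟨_, hx, (key _).2 (by rw [hx])⟩

/-- The operator `τ - T₂₂^•` on `dom T₂₂^•`. -/
def shift₂₂ : S.friedrichs₂₂.domain →ₗ[ℂ] H₂ :=
  (S.τ : ℂ) • S.friedrichs₂₂.domain.subtype - S.friedrichs₂₂.toFun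

lemma adjoint_shift₂₂ (x : S.friedrichs₂₂.domain) :
    S.I₂ (S.I₂.adjoint (S.shift₂₂ x)) = x :=
  (S.mem_graph_friedrichs₂₂ x (S.friedrichs₂₂ x)).1 (S.friedrichs₂₂.mem_graph x)

lemma shift₂₂_bijective : Function.Bijective S.shift₂₂ := by
  constructor
  · intro x y hxy
    apply Subtype.ext
    rw [← S.adjoint_shift₂₂ x, ← S.adjoint_shift₂₂ y, hxy]
  · intro w
    have h := (S.mem_graph_friedrichs₂₂ (S.I₂ (S.I₂.adjoint w))
      ((S.τ : ℂ) • S.I₂ (S.I₂.adjoint w) - w)).2 (by simp)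
    rw [LinearPMap.mem_graph_iff] at h
    obtain ⟨x, hx, hx'⟩ := h
    refine ⟨x, ?_⟩
    change (S.τ : ℂ) • (x : H₂) - S.friedrichs₂₂ x = w
    simp only at hx hx'
    rw [hx', hx]
    simp

/-- The operator `(τ - T₂₂^•)⁻¹ : H₂ → H₂`. -/
def resolvent₂₂ : H₂ →ₗ[ℂ] H₂ :=
  S.friedrichs₂₂.domain.subtype ∘ₗ
    (LinearEquiv.ofBijective S.shift₂₂ S.shift₂₂_bijective).symm.toLinearMap

lemma resolvent₂₂_eq (w : H₂) : S.resolvent₂₂ w = S.I₂ (S.I₂.adjoint w) := by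
  obtain ⟨x, rfl⟩ := S.shift₂₂_bijective.2 w
  rw [S.adjoint_shift₂₂]
  have : (LinearEquiv.ofBijective S.shift₂₂ S.shift₂₂_bijective).symm (S.shift₂₂ x) = x :=
    (LinearEquiv.ofBijective S.shift₂₂ S.shift₂₂_bijective).symm_apply_apply x
  simp [resolvent₂₂, this]

lemma inner_resolvent₂₂ (v w : H₂) :
    (inner ℂ v (S.resolvent₂₂ w) : ℂ) = inner ℂ (S.I₂.adjoint v) (S.I₂.adjoint w) := by
  rw [S.resolvent₂₂_eq, ContinuousLinearMap.adjoint_inner_left]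

/-- The form `⟨(T₁₁ - ϰ) x, y⟩ + ⟨(τ - T₂₂^•)⁻¹ T₂₁ x, T₂₁ y⟩` on `dom T₁₁`. -/
def energy₁ : EnergyForm H₁ where
  dom := S.T₁₁.domain
  form x y := inner ℂ (x : H₁) (S.T₁₁ y - (S.ϰ : ℂ) • (y : H₁)) +
    inner ℂ (S.T₂₁ x) (S.resolvent₂₂ (S.T₂₁ y))
  conj_symm x y := by
    rw [map_add, inner_conj_symm, inner_sub_left, inner_sub_right, S.symm₁₁ x y, inner_smul_left,
      inner_smul_right, Complex.conj_ofReal, S.inner_resolvent₂₂, S.inner_resolvent₂₂,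
      inner_conj_symm]
  add_left x y z := by simp only [Submodule.coe_add, map_add, inner_add_left]; ring
  smul_left x y c := by simp only [Submodule.coe_smul, map_smul, inner_smul_left]; ring
  coercive x := by
    have h := S.lower x
    have h' : 0 ≤ (inner ℂ (S.T₂₁ x) (S.resolvent₂₂ (S.T₂₁ x)) : ℂ).re := by
      rw [S.inner_resolvent₂₂]
      exact inner_self_nonneg (𝕜 := ℂ)
    rw [Complex.add_re]
    linarith

variable [CompleteSpace H₁]

/-- The space `D₁`. -/
abbrev D₁ : Type _ := S.energy₁.Space

/-- The embedding operator `I₁ : D₁ → H₁`. -/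
def I₁ : S.D₁ →L[ℂ] H₁ := S.energy₁.incl

/-- The embedding of `dom T₁₁` into `D₁`. -/
def j₁ : S.T₁₁.domain →ₗ[ℂ] S.D₁ := S.energy₁.embed

@[simp] lemma I₁_j₁ (x : S.T₁₁.domain) : S.I₁ (S.j₁ x) = x := S.energy₁.incl_embed x

lemma dense_j₁ : DenseRange S.j₁ := S.energy₁.denseRange_embed

lemma dense_I₁ : DenseRange S.I₁ := S.energy₁.denseRange_incl S.dense₁

lemma inner_j₁ (x y : S.T₁₁.domain) :
    (inner ℂ (S.j₁ x) (S.j₁ y) : ℂ) = inner ℂ (x : H₁) (S.T₁₁ y - (S.ϰ : ℂ) • (y : H₁)) +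
      inner ℂ (S.I₂.adjoint (S.T₂₁ x)) (S.I₂.adjoint (S.T₂₁ y)) := by
  rw [← S.inner_resolvent₂₂]
  exact S.energy₁.inner_embed x y

lemma norm_adjoint_T₂₁_le (x : S.T₁₁.domain) : ‖S.I₂.adjoint (S.T₂₁ x)‖ ≤ ‖S.j₁ x‖ := by
  refine le_of_sq_le_sq ?_ (norm_nonneg _)
  rw [← inner_self_eq_norm_sq (𝕜 := ℂ), ← inner_self_eq_norm_sq (𝕜 := ℂ), S.inner_j₁]
  have := (sq_nonneg _).trans (S.lower x)
  simpa using this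

/-- Auxiliary bounded operator with `j₁ x ↦ I₂† T₂₁ x`, `I₂†` the Hilbert space adjoint. -/
def aux₂₁ : S.D₁ →L[ℂ] S.D₂ :=
  (S.I₂.adjoint.toLinearMap ∘ₗ S.T₂₁).extendOfNorm S.j₁

lemma aux₂₁_j₁ (x : S.T₁₁.domain) : S.aux₂₁ (S.j₁ x) = S.I₂.adjoint (S.T₂₁ x) :=
  LinearMap.extendOfNorm_eq S.dense_j₁
    ⟨1, fun x => by simpa using S.norm_adjoint_T₂₁_le x⟩ x

lemma I₁_injective : Function.Injective S.I₁ := by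
  refine S.energy₁.incl_injective fun y hy (z : S.T₁₁.domain) => ?_
  have hy : S.I₁ y = 0 := hy
  have h0 : S.aux₂₁ y = 0 := by
    refine S.dense_j₂.eq_zero_of_inner_left ℂ fun v => ?_
    have : (inner ℂ (S.aux₂₁ y) (S.j₂ v) : ℂ) = inner ℂ (S.I₁ y) (S.T₁₂ v) := by
      refine S.dense_j₁.induction_on (p := fun y => (inner ℂ (S.aux₂₁ y) (S.j₂ v) : ℂ) =
        inner ℂ (S.I₁ y) (S.T₁₂ v)) y (isClosed_eq (by fun_prop) (by fun_prop)) fun y => ?_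
      rw [S.aux₂₁_j₁, ContinuousLinearMap.adjoint_inner_left, S.I₂_j₂, S.symm₂₁, S.I₁_j₁]
    rw [this, hy, inner_zero_left]
  have : (inner ℂ y (S.j₁ z) : ℂ) =
      inner ℂ (S.I₁ y) (S.T₁₁ z - (S.ϰ : ℂ) • (z : H₁)) +
        inner ℂ (S.aux₂₁ y) (S.aux₂₁ (S.j₁ z)) := by
    refine S.dense_j₁.induction_on (p := fun y => (inner ℂ y (S.j₁ z) : ℂ) =
      inner ℂ (S.I₁ y) (S.T₁₁ z - (S.ϰ : ℂ) • (z : H₁)) +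
        inner ℂ (S.aux₂₁ y) (S.aux₂₁ (S.j₁ z))) y
      (isClosed_eq (by fun_prop) (by fun_prop)) fun y => ?_
    rw [S.inner_j₁, S.aux₂₁_j₁, S.aux₂₁_j₁, S.I₁_j₁]
  refine Eq.trans this ?_
  rw [h0, hy, inner_zero_left, inner_zero_left, add_zero]

/-- The space `D = D₁ ⊕ D₂`. -/
abbrev D : Type _ := WithLp 2 (S.D₁ × S.D₂)

/-- The embedding operator `I = I₁ ⊕ I₂ : D → H₁ ⊕ H₂`. -/
def I : S.D →L[ℂ] WithLp 2 (H₁ × H₂) :=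
  (WithLp.prodContinuousLinearEquiv 2 ℂ H₁ H₂).symm.toContinuousLinearMap ∘L
    (S.I₁.prodMap S.I₂) ∘L
      (WithLp.prodContinuousLinearEquiv 2 ℂ S.D₁ S.D₂).toContinuousLinearMap

/-- The embedding of `dom T = dom T₁₁ ⊕ dom T₂₂` into `D`. -/
def j : S.toOperator.domain →ₗ[ℂ] S.D where
  toFun p := WithLp.toLp 2 (S.j₁ ⟨p.1.fst, p.2.1⟩, S.j₂ ⟨p.1.snd, p.2.2⟩)
  map_add' p q := by
    rw [← WithLp.toLp_add, Prod.mk_add_mk, ← map_add, ← map_add]; rfl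
  map_smul' c p := by
    rw [RingHom.id_apply, ← WithLp.toLp_smul, Prod.smul_mk, ← map_smul, ← map_smul]; rfl

@[simp] lemma I_j (p : S.toOperator.domain) : S.I (S.j p) = p := by
  change WithLp.toLp 2 (S.I₁ (S.j₁ _), S.I₂ (S.j₂ _)) = _
  rw [S.I₁_j₁, S.I₂_j₂]
  rfl

lemma dense_j : DenseRange S.j := by
  have h := S.dense_j₁.prodMap S.dense_j₂
  have h1 : DenseRange (WithLp.prodContinuousLinearEquiv 2 ℂ S.D₁ S.D₂).symm :=
    (WithLp.prodContinuousLinearEquiv 2 ℂ S.D₁ S.D₂).symm.surjective.denseRange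
  refine (h1.comp h (by fun_prop)).mono ?_
  rintro _ ⟨⟨x, u⟩, rfl⟩
  exact ⟨⟨WithLp.toLp 2 ((x : H₁), (u : H₂)), x.2, u.2⟩, rfl⟩

lemma dense_I : DenseRange S.I := by
  refine S.symm.1.mono ?_
  intro p hp
  exact ⟨S.j ⟨p, hp⟩, S.I_j _⟩

lemma I_injective : Function.Injective S.I := by
  rw [injective_iff_map_eq_zero]
  intro y hy
  have h1 : S.I₁ y.fst = 0 := congrArg WithLp.fst hy
  have h2 : S.I₂ y.snd = 0 := congrArg WithLp.snd hy
  rw [map_eq_zero_iff _ S.I₁_injective] at h1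
  rw [map_eq_zero_iff _ S.I₂_injective] at h2
  exact WithLp.ofLp_injective 2 (Prod.ext h1 h2)

/-- The bounded operator `D → D^*` extending `I^* T I`. -/
def TExt : S.D →L[ℂ] Rigging.AntiDual S.D :=
  Rigging.extension S.I S.j S.toOperator.toFun

lemma bound₁₁ (x z : S.T₁₁.domain) :
    ‖(inner ℂ (z : H₁) (S.T₁₁ x) : ℂ)‖ ≤ (|S.ϰ| + 2) * (‖S.j₁ x‖ * ‖S.j₁ z‖) := by
  have h : (inner ℂ (z : H₁) (S.T₁₁ x) : ℂ) = inner ℂ (S.j₁ z) (S.j₁ x) -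
      inner ℂ (S.I₂.adjoint (S.T₂₁ z)) (S.I₂.adjoint (S.T₂₁ x)) +
        S.ϰ * inner ℂ (z : H₁) (x : H₁) := by
    rw [S.inner_j₁, inner_sub_right, inner_smul_right]; ring
  rw [h]
  refine (norm_add_le _ _).trans ((add_le_add_left (norm_sub_le _ _) _).trans ?_)
  rw [norm_mul, Complex.norm_real, Real.norm_eq_abs]
  have h1 := norm_inner_le_norm (𝕜 := ℂ) (S.j₁ z) (S.j₁ x)
  have h2 := (norm_inner_le_norm (𝕜 := ℂ) (S.I₂.adjoint (S.T₂₁ z)) (S.I₂.adjoint (S.T₂₁ x))).trans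
    (mul_le_mul (S.norm_adjoint_T₂₁_le z) (S.norm_adjoint_T₂₁_le x) (norm_nonneg _)
      (norm_nonneg _))
  have h3 := (norm_inner_le_norm (𝕜 := ℂ) (z : H₁) (x : H₁)).trans
    (mul_le_mul (S.energy₁.norm_le z) (S.energy₁.norm_le x) (norm_nonneg _) (norm_nonneg _))
  have h4 := mul_le_mul_of_nonneg_left h3 (abs_nonneg S.ϰ)
  change _ ≤ |S.ϰ| * (‖S.j₁ z‖ * ‖S.j₁ x‖) at h4
  linarith [mul_comm ‖S.j₁ z‖ ‖S.j₁ x‖, mul_assoc |S.ϰ| ‖S.j₁ z‖ ‖S.j₁ x‖,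
    show (|S.ϰ| + 2) * (‖S.j₁ x‖ * ‖S.j₁ z‖) =
      |S.ϰ| * (‖S.j₁ z‖ * ‖S.j₁ x‖) + 2 * (‖S.j₁ z‖ * ‖S.j₁ x‖) by ring]

lemma bound₂₁ (x : S.T₁₁.domain) (v : S.T₂₂.domain) :
    ‖(inner ℂ (v : H₂) (S.T₂₁ x) : ℂ)‖ ≤ ‖S.j₁ x‖ * ‖S.j₂ v‖ := by
  have h : (inner ℂ (v : H₂) (S.T₂₁ x) : ℂ) = inner ℂ (S.j₂ v) (S.I₂.adjoint (S.T₂₁ x)) := by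
    rw [ContinuousLinearMap.adjoint_inner_right, S.I₂_j₂]
  rw [h, mul_comm]
  exact (norm_inner_le_norm _ _).trans
    (mul_le_mul_of_nonneg_left (S.norm_adjoint_T₂₁_le x) (norm_nonneg _))

lemma bound (p q : S.toOperator.domain) :
    ‖(inner ℂ (S.I (S.j q)) (S.toOperator p) : ℂ)‖ ≤
      (|S.ϰ| + |S.τ| + 5) * ‖S.j p‖ * ‖S.j q‖ := by
  obtain ⟨p, hp⟩ := p
  obtain ⟨q, hq⟩ := q
  set x : S.T₁₁.domain := ⟨p.fst, hp.1⟩ with hx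
  set u : S.T₂₂.domain := ⟨p.snd, hp.2⟩ with hu
  set z : S.T₁₁.domain := ⟨q.fst, hq.1⟩ with hz
  set v : S.T₂₂.domain := ⟨q.snd, hq.2⟩ with hv
  have e : (inner ℂ (S.I (S.j ⟨q, hq⟩)) (S.toOperator ⟨p, hp⟩) : ℂ) =
      (inner ℂ (z : H₁) (S.T₁₁ x) + inner ℂ (z : H₁) (S.T₁₂ u)) +
        (inner ℂ (v : H₂) (S.T₂₁ x) + inner ℂ (v : H₂) (S.T₂₂ u)) := by
    rw [S.I_j, ← inner_add_right, ← inner_add_right]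
    rfl
  have b1 := S.bound₁₁ x z
  have b2 := S.bound₂₁ z u
  rw [← inner_conj_symm, RCLike.norm_conj, S.symm₂₁] at b2
  have b3 := S.bound₂₁ x v
  have b4 := S.bound₂₂ u v
  rw [S.I₂_j₂] at b4
  have np1 : ‖S.j₁ x‖ ≤ ‖S.j ⟨p, hp⟩‖ := WithLp.norm_fst_le _ (S.j ⟨p, hp⟩)
  have np2 : ‖S.j₂ u‖ ≤ ‖S.j ⟨p, hp⟩‖ := WithLp.norm_snd_le _ (S.j ⟨p, hp⟩)
  have nq1 : ‖S.j₁ z‖ ≤ ‖S.j ⟨q, hq⟩‖ := WithLp.norm_fst_le _ (S.j ⟨q, hq⟩)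
  have nq2 : ‖S.j₂ v‖ ≤ ‖S.j ⟨q, hq⟩‖ := WithLp.norm_snd_le _ (S.j ⟨q, hq⟩)
  rw [e]
  refine (norm_add_le _ _).trans
    ((add_le_add (norm_add_le _ _) (norm_add_le _ _)).trans ?_)
  have c1 := b1.trans (mul_le_mul_of_nonneg_left
    (mul_le_mul np1 nq1 (norm_nonneg _) (norm_nonneg _)) (by positivity))
  have c2 := b2.trans (mul_le_mul nq1 np2 (norm_nonneg _) (norm_nonneg _))
  have c3 := b3.trans (mul_le_mul np1 nq2 (norm_nonneg _) (norm_nonneg _))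
  rw [mul_assoc] at b4
  have c4 := b4.trans (mul_le_mul_of_nonneg_left
    (mul_le_mul np2 nq2 (norm_nonneg _) (norm_nonneg _)) (by positivity))
  linarith

lemma TExt_j (p : S.toOperator.domain) :
    S.TExt (S.j p) = Rigging.dualMap S.I (S.toOperator p) :=
  Rigging.extension_apply S.I S.j S.toOperator.toFun S.dense_j _ (by positivity) S.bound p

/-- The angular extension `T^• = (I^*)⁻¹ T I⁻¹` of the operator matrix. -/
def angularExtension : WithLp 2 (H₁ × H₂) →ₗ.[ℂ] WithLp 2 (H₁ × H₂) :=
  Rigging.bullet S.I S.TExt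

lemma mem_graph_angularExtension (x h : WithLp 2 (H₁ × H₂)) :
    (x, h) ∈ S.angularExtension.graph ↔ ∃ y : S.D, S.I y = x ∧ S.TExt y = Rigging.dualMap S.I h :=
  Rigging.mem_graph_bullet _ _ S.I_injective S.dense_I x h

end AngularData

end

/-! Write `F` for `aux₂₁ : D₁ → D₂`, the continuous extension of `I₂† T₂₁`, and `K = ϰ ⊕ τ`. The
norm of `D₁` is chosen so that the Schur complement of `T - K` with respect to its lower right
corner becomes the scalar product of `D₁`, while `τ - T₂₂` becomes that of `D₂`. Hence the form of
`T - I^* K I` on `D = D₁ ⊕ D₂` is `⟨y₁, z₁⟩ - ⟨y₂ - F y₁, z₂ - F z₁⟩` (`TExt_apply`). Since `F` is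
bounded, this is a block triangular, boundedly invertible change of variables applied to the
signature form `diag(1, -1)`.

Such a form represents every functional `I^* w`, so `T^• - K` is onto
(`angularExtension_sub_diagonal_surjective`). The form is Hermitian, so `T^•` is symmetric. A
densely defined symmetric operator that becomes surjective after subtracting an everywhere defined
symmetric operator has no room for a larger adjoint. One real shift therefore suffices, with no need
for the pair of points `±i`. -/

/-- A densely defined symmetric operator `A` is self-adjoint if `A - K` is surjective for some
everywhere defined symmetric operator `K`. -/
theorem LinearPMap.IsFormalAdjoint.isSelfAdjoint_of_sub_surjective {𝕜 E : Type*} [RCLike 𝕜]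
    [NormedAddCommGroup E] [InnerProductSpace 𝕜 E] [CompleteSpace E] {A : E →ₗ.[𝕜] E}
    (hA : A.IsFormalAdjoint A) (hd : Dense (A.domain : Set E)) {K : E →ₗ[𝕜] E}
    (hK : K.IsSymmetric) (hs : ∀ w : E, ∃ x : A.domain, A x - K x = w) : IsSelfAdjoint A := by
  have hle : A ≤ A.adjoint := hA.le_adjoint hd
  refine (LinearPMap.eq_of_le_of_domain_eq hle (le_antisymm hle.1 fun y hy => ?_)).symm
  -- To show that `y` lies in `dom A`, take `x` in `dom A` on which `A - K` has the value that `A† -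
  -- K` has at `y`.
  obtain ⟨x, hx⟩ := hs (A.adjoint ⟨y, hy⟩ - K y)
  -- By symmetry `y - x` is orthogonal to the range of `A - K`, which is the whole space.
  have hyx : y - x = 0 := by
    refine ext_inner_right 𝕜 fun w => ?_
    obtain ⟨d, rfl⟩ := hs w
    have h1 := LinearPMap.adjoint_isFormalAdjoint hd ⟨y, hy⟩ d
    have h2 := hA x d
    have h3 := congrArg (fun v => inner 𝕜 v (d : E)) hx
    simp only [inner_sub_left] at h3
    rw [h1, h2, hK, hK] at h3
    rw [inner_zero_left, inner_sub_left, inner_sub_right, inner_sub_right, h3, sub_self]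
  rw [sub_eq_zero.1 hyx]
  exact x.2

/-! ### Block factorization of the form of the angular extension. -/

namespace AngularData

variable {H₁ H₂ : Type*} [NormedAddCommGroup H₁] [InnerProductSpace ℂ H₁] [CompleteSpace H₁]
  [NormedAddCommGroup H₂] [InnerProductSpace ℂ H₂] [CompleteSpace H₂] (S : AngularData H₁ H₂)

/-- The form of the angular extension, with the Frobenius–Schur factorization displayed. -/
lemma TExt_apply (y z : S.D) : S.TExt y z =
    inner ℂ z.fst y.fst - inner ℂ (z.snd - S.aux₂₁ z.fst) (y.snd - S.aux₂₁ y.fst) +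
      S.ϰ * inner ℂ (S.I₁ z.fst) (S.I₁ y.fst) + S.τ * inner ℂ (S.I₂ z.snd) (S.I₂ y.snd) := by
  -- Both sides are continuous in each variable, so it is enough to compare them on the image of
  -- `dom T°`, where `TExt` is given by the matrix entries.
  refine S.dense_j.induction_on (p := fun z => S.TExt y z =
    inner ℂ z.fst y.fst - inner ℂ (z.snd - S.aux₂₁ z.fst) (y.snd - S.aux₂₁ y.fst) +
      S.ϰ * inner ℂ (S.I₁ z.fst) (S.I₁ y.fst) + S.τ * inner ℂ (S.I₂ z.snd) (S.I₂ y.snd)) z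
    (isClosed_eq (by fun_prop) (by fun_prop)) fun q => ?_
  refine S.dense_j.induction_on (p := fun y => S.TExt y (S.j q) =
    inner ℂ (S.j q).fst y.fst -
        inner ℂ ((S.j q).snd - S.aux₂₁ (S.j q).fst) (y.snd - S.aux₂₁ y.fst) +
      S.ϰ * inner ℂ (S.I₁ (S.j q).fst) (S.I₁ y.fst) +
      S.τ * inner ℂ (S.I₂ (S.j q).snd) (S.I₂ y.snd)) y
    (isClosed_eq (by fun_prop) (by fun_prop)) fun p => ?_
  rw [S.TExt_j, Rigging.dualMap_apply, S.I_j]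
  obtain ⟨p, hp⟩ := p
  obtain ⟨q, hq⟩ := q
  set x : S.T₁₁.domain := ⟨p.fst, hp.1⟩
  set u : S.T₂₂.domain := ⟨p.snd, hp.2⟩
  set z : S.T₁₁.domain := ⟨q.fst, hq.1⟩
  set v : S.T₂₂.domain := ⟨q.snd, hq.2⟩
  change (inner ℂ (z : H₁) (S.T₁₁ x + S.T₁₂ u) + inner ℂ (v : H₂) (S.T₂₁ x + S.T₂₂ u) : ℂ) =
    inner ℂ (S.j₁ z) (S.j₁ x) -
        inner ℂ (S.j₂ v - S.aux₂₁ (S.j₁ z)) (S.j₂ u - S.aux₂₁ (S.j₁ x)) +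
      S.ϰ * inner ℂ (S.I₁ (S.j₁ z)) (S.I₁ (S.j₁ x)) +
      S.τ * inner ℂ (S.I₂ (S.j₂ v)) (S.I₂ (S.j₂ u))
  -- The term `⟨I₂† T₂₁ z, I₂† T₂₁ x⟩` in the scalar product of `D₁` cancels the one from the
  -- completed square. The cross terms of the square give `T₂₁` directly and `T₁₂` through `symm₂₁`.
  rw [S.aux₂₁_j₁, S.aux₂₁_j₁, S.I₁_j₁, S.I₁_j₁, inner_sub_left, inner_sub_right,
    inner_sub_right, S.inner_j₁, S.inner_j₂]
  simp only [ContinuousLinearMap.adjoint_inner_left, ContinuousLinearMap.adjoint_inner_right,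
    I₂_j₂, S.symm₂₁, inner_add_right, inner_sub_right, inner_smul_right]
  ring

/-- Each term of the factorized form is Hermitian, because `ϰ` and `τ` are real. -/
lemma conj_TExt_apply (y z : S.D) : conj (S.TExt y z) = S.TExt z y := by
  simp only [TExt_apply, map_add, map_sub, map_mul, inner_conj_symm, Complex.conj_ofReal]

/-! ### The shift, and the symmetry and dense domain of the angular extension. -/

/-- The diagonal operator `ϰ ⊕ τ` in `H₁ ⊕ H₂`. -/
def diagonal : WithLp 2 (H₁ × H₂) →ₗ[ℂ] WithLp 2 (H₁ × H₂) where
  toFun p := WithLp.toLp 2 ((S.ϰ : ℂ) • p.fst, (S.τ : ℂ) • p.snd)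
  map_add' _ _ := WithLp.ofLp_injective 2 (Prod.ext (smul_add _ _ _) (smul_add _ _ _))
  map_smul' _ _ := WithLp.ofLp_injective 2 (Prod.ext (smul_comm _ _ _) (smul_comm _ _ _))

lemma diagonal_isSymmetric : S.diagonal.IsSymmetric := fun p q => by
  change inner ℂ ((S.ϰ : ℂ) • p.fst) q.fst + inner ℂ ((S.τ : ℂ) • p.snd) q.snd =
    inner ℂ p.fst ((S.ϰ : ℂ) • q.fst) + inner ℂ p.snd ((S.τ : ℂ) • q.snd)
  simp only [inner_smul_left, inner_smul_right, Complex.conj_ofReal]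

lemma angularExtension_isFormalAdjoint :
    S.angularExtension.IsFormalAdjoint S.angularExtension := fun x x' => by
  obtain ⟨y, hy, hT⟩ := (S.mem_graph_angularExtension _ _).1 (S.angularExtension.mem_graph x)
  obtain ⟨y', hy', hT'⟩ := (S.mem_graph_angularExtension _ _).1 (S.angularExtension.mem_graph x')
  -- Both scalar products in `H₁ ⊕ H₂` are values of the form on `D`, since `TExt y` and `TExt y'`
  -- are represented by vectors of that space.
  rw [← hy, ← hy', ← inner_conj_symm, ← Rigging.dualMap_apply, ← Rigging.dualMap_apply,
    ← hT, ← hT', conj_TExt_apply]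

/-- The angular extension does extend `T°`, by `TExt_j`, and `dom T°` is already dense. -/
lemma dense_domain_angularExtension :
    Dense (S.angularExtension.domain : Set (WithLp 2 (H₁ × H₂))) :=
  S.symm.1.mono fun p hp => LinearPMap.mem_domain_of_mem_graph
    ((S.mem_graph_angularExtension p (S.toOperator ⟨p, hp⟩)).2
      ⟨S.j ⟨p, hp⟩, S.I_j _, S.TExt_j _⟩)

/-! ### Solving the shifted equation by block elimination. -/

lemma angularExtension_sub_diagonal_surjective (w : WithLp 2 (H₁ × H₂)) :
    ∃ x : S.angularExtension.domain, S.angularExtension x - S.diagonal x = w := by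
  -- With `y = (x, u)`, testing against `z = (0, z₂)` forces `u - F x = -g`. Testing against `z =
  -- (z₁, 0)` then leaves `⟨z₁, x⟩ - ⟨F z₁, g⟩ = ⟨I₁ z₁, w₁⟩`, which determines `x`.
  set g : S.D₂ := S.I₂.adjoint w.snd with hg
  set x : S.D₁ := S.I₁.adjoint w.fst + S.aux₂₁.adjoint g with hx
  set y : S.D := WithLp.toLp 2 (x, S.aux₂₁ x - g)
  -- This is `(T - I^* K I) y = I^* w` with the shift moved to the right, which is the form required
  -- for membership in the graph of `T^•`. As the right side comes from a vector of `H₁ ⊕ H₂`, `I y`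
  -- lies in `dom T^•`.
  have hT : S.TExt y = Rigging.dualMap S.I (w + S.diagonal (S.I y)) := by
    ext z
    rw [TExt_apply, Rigging.dualMap_apply, inner_add_right]
    change inner ℂ z.fst x - inner ℂ (z.snd - S.aux₂₁ z.fst) (S.aux₂₁ x - g - S.aux₂₁ x) +
        S.ϰ * inner ℂ (S.I₁ z.fst) (S.I₁ x) +
        S.τ * inner ℂ (S.I₂ z.snd) (S.I₂ (S.aux₂₁ x - g)) =
      inner ℂ (S.I₁ z.fst) w.fst + inner ℂ (S.I₂ z.snd) w.snd +
        (inner ℂ (S.I₁ z.fst) ((S.ϰ : ℂ) • S.I₁ x) +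
          inner ℂ (S.I₂ z.snd) ((S.τ : ℂ) • S.I₂ (S.aux₂₁ x - g)))
    -- The `ϰ` and `τ` terms agree on both sides; what remains is the factorized equation for `w`
    -- alone.
    have h : inner ℂ z.fst x - inner ℂ (z.snd - S.aux₂₁ z.fst) (S.aux₂₁ x - g - S.aux₂₁ x) =
        inner ℂ (S.I₁ z.fst) w.fst + inner ℂ (S.I₂ z.snd) w.snd := by
      rw [sub_sub_cancel_left, inner_neg_right, inner_sub_left, hx, inner_add_right,
        ContinuousLinearMap.adjoint_inner_right, ContinuousLinearMap.adjoint_inner_right,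
        ← ContinuousLinearMap.adjoint_inner_right S.I₂, ← hg]
      ring
    rw [h, inner_smul_right, inner_smul_right]
    ring
  obtain ⟨p, hp, hp'⟩ := (LinearPMap.mem_graph_iff _).1
    ((S.mem_graph_angularExtension _ _).2 ⟨y, rfl, hT⟩)
  exact ⟨p, by rw [hp', hp, add_sub_cancel_right]⟩

end AngularData

theorem mainTheorem1 {H₁ H₂ : Type*}
    [NormedAddCommGroup H₁] [InnerProductSpace ℂ H₁] [CompleteSpace H₁]
    [NormedAddCommGroup H₂] [InnerProductSpace ℂ H₂] [CompleteSpace H₂]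
    (T : OperatorMatrix H₁ H₂) (hT : T.IsSymmetric) (ϰ τ : ℝ)
    (h₁ : ∀ y : T.T₁₁.domain,
      ‖(y : H₁)‖ ^ 2 ≤ (inner ℂ (y : H₁) (T.T₁₁ y - (ϰ : ℂ) • (y : H₁))).re)
    (h₂ : ∀ y : T.T₂₂.domain,
      ‖(y : H₂)‖ ^ 2 ≤ (inner ℂ (y : H₂) ((τ : ℂ) • (y : H₂) - T.T₂₂ y)).re) :
    IsSelfAdjoint (AngularData.angularExtension
      { toOperatorMatrix := T, ϰ := ϰ, τ := τ, symm := hT, lower := h₁, upper := h₂ }) :=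
  (AngularData.angularExtension_isFormalAdjoint _).isSelfAdjoint_of_sub_surjective
    (AngularData.dense_domain_angularExtension _) (AngularData.diagonal_isSymmetric _)
    (AngularData.angularExtension_sub_diagonal_surjective _)
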